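/- **Setting.** Let $(\Omega,\mathcal A,\mathbb P)$ be a probability space, $\mathcal X$ a locally compact Polish space, $\mathcal G$ a separable real Hilbert space and $\mathcal Y\subseteq\mathcal G$ a complete subset, all topological spaces being equipped with their Borel $\sigma$-algebras. Let $\mathcal P(S)$ denote the set of Borel probability measures on $S$ with the topology of weak convergence. *RKHS.* Let $\mathcal H$ be a separable $\mathcal G$-valued reproducing kernel Hilbert space on $\mathcal X$, that is, a separable real Hilbert space of functions $f:\mathcal X\to\mathcal G$ for which every evaluation map $S_x:\mathcal H\to\mathcal G$, $f\mapsto f(x)$, is continuous. Put $K(\cdot,x)=S_x^*\in\mathcal L(\mathcal G;\mathcal H)$ and $K(x,x')=S_xS_{x'}^*\in\mathcal L(\mathcal G)$. Assume that all $f\in\mathcal H$ are continuous, that $\sup_{x}\sqrt{\|K(x,x)\|}<\infty$, that the feature map $x\mapsto K(\cdot,x)\in\mathcal L(\mathcal G;\mathcal H)$ is continuous for the operator norm, and that the space $C_b(\mathcal X\times\mathcal Y;\mathcal H)$ of bounded continuous functions is separable for the supremum norm. *Loss.* Let $L:\mathcal X\times\mathcal Y\times\mathcal G\to[0,\infty)$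 be measurable and such that - (convex) $L(x,y,\cdot)$ is convex for all $x,y$; - (continuously differentiable) $L(x,y,\cdot)$ is Fréchet differentiable for all $x,y$, and $(x,y,t)\mapsto\nabla_tL(x,y,t)$ is continuous on $\mathcal X\times\mathcal Y\times\mathcal G$; - (locally Lipschitz) for every $a>0$ there is a constant $M$ with $|L(x,y,t)-L(x,y,t')|\le M\|t-t'\|$ for all $x,y$ and all $t,t'$ with $\|t\|,\|t'\|\le a$; - (locally bounded) $L$ is bounded on $\mathcal X\times\mathcal Y\times A$ for every bounded $A\subseteq\mathcal G$. *Risks.* For $J\in\mathcal P(\mathcal X\times\mathcal Y)$ and measurable $f:\mathcal X\to\mathcal G$ let $\mathcal R_{L,J}(f)=\int L(x,y,f(x))\,dJ(x,y)\in[0,\infty]$, and let $\mathcal R^\star_{L,J}$ be the infimum of $\mathcal R_{L,J}(f)$ over all measurable $f:\mathcal X\to\mathcal G$. The space $\mathcal H$ is called $(L,J)$-rich if $\inf_{f\in\mathcal H}\mathcal R_{L,J}(f)=\mathcal R^\star_{L,J}$. *Process.* Let $Z=(Z_n)_{n\ge1}$ be an $\mathcal X\times\mathcal Y$-valued process, $\eta_n^Z=\frac1n\sum_{i=1}^n\delta_{Z_i}$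 its empirical measures, and $J:\Omega\to\mathcal P(\mathcal X\times\mathcal Y)$ a random measure. $Z$ is *empirically weakly converging (EWC) in probability* with limit measure $J$ if $d(\eta^Z_n,J)\to0$ in probability, where $d$ is a metric that metrizes the weak convergence of probability measures, and *EWC almost surely* with limit measure $J$ if almost surely $\eta_n^Z$ converges weakly to $J$. Assume that $\mathcal H$ is $(L,J)$-rich almost surely. **Theorem.** For every $n\ge1$, every training set $z=((x_i,y_i))_{i=1}^n\in(\mathcal X\times\mathcal Y)^n$ and every $\lambda>0$, the functional $$f\in\mathcal H\;\mapsto\;\frac1n\sum_{i=1}^nL(x_i,y_i,f(x_i))+\lambda\|f\|_{\mathcal H}^2$$ has a unique minimizer $f_{z,\lambda}\in\mathcal H$. Moreover: 1. If $Z$ is EWC in probability with limit measure $J$, then there is a sequence of strictly positive real numbers $(\lambda_n)_{n\ge1}$ with $\lambda_n\to0$ such that the $(\lambda_n)$-SVM is $L$-consistent for $Z$, that is, $\mathcal R_{L,J}(f_{Z_{1:n},\lambda_n})\to\mathcal R^\star_{L,J}$ in probability, where $Z_{1:n}=(Z_1,\dots,Z_n)$. 2. If $Z$ is EWC almost surely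 with limit measure $J$, then there is a sequence of strictly positive real numbers $(\lambda_n)_{n\ge1}$ with $\lambda_n\to0$ such that the $(\lambda_n)$-SVM is strongly $L$-consistent for $Z$, that is, $\mathcal R_{L,J}(f_{Z_{1:n},\lambda_n})\to\mathcal R^\star_{L,J}$ almost surely. -/

import Mathlib

open MeasureTheory Filter Topology
open scoped ENNReal BoundedContinuousFunction

noncomputable section

namespace EWCConsistency

/-! ### Loss functions -/

section Loss

variable {X Y G : Type*}

/-- `L : X × Y × G → [0, ∞)` is a loss function: it is nonnegative and (jointly) measurable. -/
structure IsLoss [MeasurableSpace X] [MeasurableSpace Y] [MeasurableSpace G]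
    (L : X → Y → G → ℝ) : Prop where
  nonneg : ∀ x y t, 0 ≤ L x y t
  measurable : Measurable fun p : X × Y × G => L p.1 p.2.1 p.2.2

/-- The loss is convex in its last argument. -/
def IsConvexLoss [NormedAddCommGroup G] [InnerProductSpace ℝ G] (L : X → Y → G → ℝ) : Prop :=
  ∀ x y, ConvexOn ℝ Set.univ (L x y)

/-- The loss is bounded on `X × Y × A` for every bounded `A ⊆ G`. -/
def IsLocallyBoundedLoss [NormedAddCommGroup G] (L : X → Y → G → ℝ) : Prop :=
  ∀ A : Set G, Bornology.IsBounded A → ∃ M : ℝ, ∀ x y, ∀ t ∈ A, |L x y t| ≤ M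

/-- For every radius `a > 0`, the functions `L x y` are Lipschitz continuous on the ball
`{‖t‖ ≤ a}`, with a constant that does not depend on `x` and `y`. -/
def IsLocallyLipschitzLoss [NormedAddCommGroup G] (L : X → Y → G → ℝ) : Prop :=
  ∀ a : ℝ, 0 < a → ∃ M : ℝ, ∀ x y t t', ‖t‖ ≤ a → ‖t'‖ ≤ a →
    |L x y t - L x y t'| ≤ M * ‖t - t'‖

/-- The loss is Fréchet differentiable in its last argument, and its gradient in this argument
is jointly continuous on `X × Y × G`. -/
structure IsContDiffLoss [TopologicalSpace X] [TopologicalSpace Y] [NormedAddCommGroup G]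
    [InnerProductSpace ℝ G] [CompleteSpace G] (L : X → Y → G → ℝ) : Prop where
  differentiable : ∀ x y, Differentiable ℝ (L x y)
  continuous_gradient :
    Continuous fun p : X × Y × G => gradient (L p.1 p.2.1) p.2.2

end Loss

/-! ### Risks -/

section Risk

variable {X Y G : Type*} [MeasurableSpace X] [MeasurableSpace Y]

/-- The `L`-risk `∫ L(x, y, f(x)) dJ(x, y)`, with values in `[0, ∞]`. -/
def risk (L : X → Y → G → ℝ) (J : ProbabilityMeasure (X × Y)) (f : X → G) : ℝ≥0∞ :=
  ∫⁻ p, ENNReal.ofReal (L p.1 p.2 (f p.1)) ∂(J : Measure (X × Y))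

/-- The Bayes `L`-risk: the infimum of the risk over all measurable functions. -/
def bayesRisk [MeasurableSpace G] (L : X → Y → G → ℝ) (J : ProbabilityMeasure (X × Y)) : ℝ≥0∞ :=
  ⨅ (f : X → G) (_ : Measurable f), risk L J f

/-- The set of functions `F` is `(L, J)`-rich. -/
def IsRich [MeasurableSpace G] (F : Set (X → G)) (L : X → Y → G → ℝ)
    (J : ProbabilityMeasure (X × Y)) : Prop :=
  (⨅ f ∈ F, risk L J f) = bayesRisk L J

end Risk

/-! ### Empirical measures and empirical weak convergence

Processes are indexed by `ℕ`: `Z 0, Z 1, …` stand for the first, second, … observation. The sample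
of size `n + 1` is `(Z 0, …, Z n)`, so that the index `n` in the sequences below always belongs to
samples of size `n + 1`. -/

section Empirical

variable {S : Type*} [MeasurableSpace S]

/-- The empirical measure `(n + 1)⁻¹ ∑ δ_{z i}` of a sample of size `n + 1`. -/
def empiricalMeasure {n : ℕ} (z : Fin (n + 1) → S) : ProbabilityMeasure S :=
  ⟨((n + 1 : ℕ) : ℝ≥0∞)⁻¹ • ∑ i, Measure.dirac (z i), by
    constructor
    simp only [Measure.smul_apply, Measure.coe_finsetSum, Finset.sum_apply, measure_univ,
      Finset.sum_const, Finset.card_univ, Fintype.card_fin, nsmul_eq_mul, mul_one, smul_eq_mul]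
    exact ENNReal.inv_mul_cancel (by simp) (ENNReal.natCast_ne_top _)⟩

/-- The first `n + 1` observations of the process `Z` at the outcome `ω`. -/
def sample {Ω : Type*} (Z : ℕ → Ω → S) (n : ℕ) (ω : Ω) : Fin (n + 1) → S :=
  fun i => Z i ω

variable [TopologicalSpace S] [OpensMeasurableSpace S]

/-- The process `Z` is empirically weakly converging in probability with (random) limit measure
`J`: for a metric `d` that metrizes weak convergence of probability measures, the distance of the
empirical measure of the first `n + 1` observations to `J` tends to zero in probability. -/
structure IsEWCInProb {Ω : Type*} [MeasurableSpace Ω] (P : Measure Ω) (Z : ℕ → Ω → S)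
    (J : Ω → ProbabilityMeasure S) : Prop where
  measurable_process : ∀ n, Measurable (Z n)
  measurable_limit : Measurable J
  tendsto : ∃ d : MetricSpace (ProbabilityMeasure S),
    d.toPseudoMetricSpace.toUniformSpace.toTopologicalSpace =
      (inferInstance : TopologicalSpace (ProbabilityMeasure S)) ∧
    ∀ ε : ℝ, 0 < ε →
      Tendsto (fun n => P {ω | ε ≤ d.dist (empiricalMeasure (sample Z n ω)) (J ω)}) atTop (𝓝 0)

/-- The process `Z` is empirically weakly converging almost surely with (random) limit measure
`J`: almost surely, the empirical measures converge weakly to `J`. -/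
structure IsEWCAlmostSurely {Ω : Type*} [MeasurableSpace Ω] (P : Measure Ω) (Z : ℕ → Ω → S)
    (J : Ω → ProbabilityMeasure S) : Prop where
  measurable_process : ∀ n, Measurable (Z n)
  measurable_limit : Measurable J
  tendsto : ∀ᵐ ω ∂P, Tendsto (fun n => empiricalMeasure (sample Z n ω)) atTop (𝓝 (J ω))

end Empirical

/-! ### Learning methods and consistency -/

section Learning

variable {X Y G : Type*} [MeasurableSpace X] [MeasurableSpace Y] [MeasurableSpace G]

/-- A learning method maps every training set of size `n + 1` to a measurable function. -/
abbrev LearningMethod (X Y G : Type*) [MeasurableSpace X] [MeasurableSpace G] : Type _ :=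
  (n : ℕ) → (Fin (n + 1) → X × Y) → {f : X → G // Measurable f}

/-- `L`-consistency for the process `Z` with random limit measure `J`: the risks (with respect to
`J`) of the learned functions converge in probability to the Bayes risk. -/
def IsConsistent {Ω : Type*} [MeasurableSpace Ω] (P : Measure Ω) (L : X → Y → G → ℝ)
    (𝔏 : LearningMethod X Y G) (Z : ℕ → Ω → X × Y) (J : Ω → ProbabilityMeasure (X × Y)) : Prop :=
  TendstoInMeasure P (fun n ω => risk L (J ω) (𝔏 n (sample Z n ω)).1) atTop
    (fun ω => bayesRisk L (J ω))

/-- Strong `L`-consistency: the same convergence, almost surely. -/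
def IsStronglyConsistent {Ω : Type*} [MeasurableSpace Ω] (P : Measure Ω) (L : X → Y → G → ℝ)
    (𝔏 : LearningMethod X Y G) (Z : ℕ → Ω → X × Y) (J : Ω → ProbabilityMeasure (X × Y)) : Prop :=
  ∀ᵐ ω ∂P, Tendsto (fun n => risk L (J ω) (𝔏 n (sample Z n ω)).1) atTop (𝓝 (bayesRisk L (J ω)))

end Learning

/-! ### Support vector machines -/

section SVM

variable {X Y G : Type*} [MeasurableSpace X] [MeasurableSpace Y]
  [NormedAddCommGroup G] [InnerProductSpace ℝ G]
  {H : Type*} [NormedAddCommGroup H] [InnerProductSpace ℝ H] [RKHS ℝ H X G]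

/-- The regularized empirical risk `R_{L, η_z}(f) + lam ‖f‖²` of `f ∈ H` on the training set `z`. -/
def regularizedRisk (L : X → Y → G → ℝ) (lam : ℝ) {n : ℕ} (z : Fin (n + 1) → X × Y)
    (f : H) : ℝ≥0∞ :=
  risk L (empiricalMeasure z) (f : X → G) + ENNReal.ofReal (lam * ‖f‖ ^ 2)

/-- `f` minimizes the regularized empirical risk over `H`. -/
def IsSVMSolution (L : X → Y → G → ℝ) (lam : ℝ) {n : ℕ} (z : Fin (n + 1) → X × Y)
    (f : H) : Prop :=
  ∀ g : H, regularizedRisk L lam z f ≤ regularizedRisk L lam z g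

variable (H) in
/-- The minimizer of the regularized empirical risk over `H` (an arbitrary element of `H` if there
is none). -/
def svmSolution (L : X → Y → G → ℝ) (lam : ℝ) {n : ℕ} (z : Fin (n + 1) → X × Y) : H :=
  Classical.epsilon fun f : H => IsSVMSolution L lam z f

variable (H) in
/-- The `(lam n)`-SVM: the learning method that maps a training set of size `n + 1` to the minimizer
of the regularized empirical risk with regularization parameter `lam n`. -/
def svm [MeasurableSpace G] (hH : ∀ f : H, Measurable (f : X → G)) (L : X → Y → G → ℝ)
    (lam : ℕ → ℝ) : LearningMethod X Y G :=
  fun n z => ⟨svmSolution H L (lam n) z, hH _⟩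

end SVM

end EWCConsistency

end

/-!
For fixed `lam > 0`, strong convexity of the regularized risk makes its minimizer a Lipschitz
function of the gradient of the risk. The gradient at a fixed `f` is the integral of a bounded
continuous Hilbert-space valued function, hence weakly continuous in the measure. The regularized
minimizer therefore depends continuously on the measure, and the risk under `J` of the minimizer for
the empirical measure converges to that of the minimizer for `J`. As `lam` tends to `0`, the latter
risk converges to the infimum of the risk over `H`, which is the Bayes risk by richness. The two
limits are combined by letting `lam n` tend to `0` slowly enough; in the almost sure case, Egorov's
theorem and the Borel–Cantelli lemma provide one sequence for almost every outcome.
-/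

noncomputable section

namespace EWCConsistency

/-! ### Regularized convex objectives on a Hilbert space -/

section ConvexOptimization

theorem existsUnique_isMinOn_of_strongConvexOn {E : Type*} [NormedAddCommGroup E]
    [NormedSpace ℝ E] [CompleteSpace E] {m : ℝ} (hm : 0 < m) {φ : E → ℝ}
    (hφ : StrongConvexOn Set.univ m φ) (hcont : Continuous φ) (hbdd : BddBelow (Set.range φ)) :
    ∃! f, IsMinOn φ Set.univ f := by
  have hhalf : ∀ f g, (⨅ h, φ h) + m / 8 * ‖f - g‖ ^ 2 ≤ (φ f + φ g) / 2 := fun f g => by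
    obtain ⟨-, hφ⟩ := hφ
    have h := hφ (Set.mem_univ f) (Set.mem_univ g) (a := 1 / 2) (b := 1 / 2)
      (by norm_num) (by norm_num) (by norm_num)
    simp only [smul_eq_mul] at h
    linarith [ciInf_le hbdd ((1 / 2 : ℝ) • f + (1 / 2 : ℝ) • g)]
  obtain ⟨u, -, hu, hu_mem⟩ := exists_seq_tendsto_sInf (Set.range_nonempty φ) hbdd
  choose f hf using hu_mem
  have hlim : Tendsto (fun n => φ (f n)) atTop (𝓝 (⨅ h, φ h)) := by
    simpa only [hf, sInf_range] using hu
  have hcauchy : CauchySeq f := by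
    refine Metric.cauchySeq_iff.mpr fun ε hε => ?_
    obtain ⟨N, hN⟩ := eventually_atTop.mp
      (hlim.eventually_lt_const (lt_add_of_pos_right _ (show 0 < m / 8 * ε ^ 2 by positivity)))
    refine ⟨N, fun k hk l hl => ?_⟩
    rw [dist_eq_norm]
    refine lt_of_pow_lt_pow_left₀ 2 hε.le (lt_of_mul_lt_mul_left ?_ (show 0 ≤ m / 8 by positivity))
    linarith [hhalf (f k) (f l), hN k hk, hN l hl]
  obtain ⟨g, hg⟩ := cauchySeq_tendsto_of_complete hcauchy
  have hmin : IsMinOn φ Set.univ g := fun h _ => by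
    rw [Set.mem_ofPred_eq, tendsto_nhds_unique ((hcont.tendsto g).comp hg) hlim]
    exact ciInf_le hbdd h
  exact ⟨g, hmin, fun h hh => (hφ.strictConvexOn hm).eq_of_isMinOn hh hmin trivial trivial⟩

theorem tendsto_of_isMinOn_add_mul_norm_sq {E ι : Type*}
    [SeminormedAddCommGroup E] {l : Filter ι} {φ : E → ℝ}
    (hbdd : BddBelow (Set.range φ)) {lam : ι → ℝ} (hpos : ∀ i, 0 ≤ lam i)
    (hlam : Tendsto lam l (𝓝 0)) {m : ι → E}
    (hm : ∀ i, IsMinOn (fun f => φ f + lam i * ‖f‖ ^ 2) Set.univ (m i)) :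
    Tendsto (fun i => φ (m i)) l (𝓝 (⨅ f, φ f)) := by
  refine tendsto_order.mpr ⟨fun c hc => .of_forall fun i => hc.trans_le (ciInf_le hbdd _),
    fun c hc => ?_⟩
  obtain ⟨f, hf⟩ := exists_lt_of_ciInf_lt hc
  have hlimf : Tendsto (fun i => φ f + lam i * ‖f‖ ^ 2) l (𝓝 (φ f)) := by
    simpa using (hlam.mul_const (‖f‖ ^ 2)).const_add (φ f)
  filter_upwards [hlimf.eventually_lt_const hf] with i hi
  have hle : φ (m i) + lam i * ‖m i‖ ^ 2 ≤ φ f + lam i * ‖f‖ ^ 2 := hm i trivial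
  linarith [mul_nonneg (hpos i) (sq_nonneg ‖m i‖)]

variable {E : Type*} [NormedAddCommGroup E] [InnerProductSpace ℝ E]

theorem strongConvexOn_add_mul_norm_sq {φ : E → ℝ} (hφ : ConvexOn ℝ Set.univ φ) (lam : ℝ) :
    StrongConvexOn Set.univ (2 * lam) fun f => φ f + lam * ‖f‖ ^ 2 := by
  rw [strongConvexOn_iff_convex]
  simpa using hφ

variable [CompleteSpace E]

theorem inner_gradient_le_sub {φ : E → ℝ} (hφ : ConvexOn ℝ Set.univ φ) {a f : E}
    (ha : HasGradientAt φ a f) (g : E) : inner ℝ a (g - f) ≤ φ g - φ f := by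
  have hline : HasDerivAt (φ ∘ AffineMap.lineMap f g) (inner ℝ a (g - f)) (0 : ℝ) := by
    rw [← InnerProductSpace.toDual_apply_apply (𝕜 := ℝ)]
    refine HasFDerivAt.comp_hasDerivAt _ ?_ AffineMap.hasDerivAt_lineMap
    simpa using ha.hasFDerivAt
  have hconv : ConvexOn ℝ Set.univ (φ ∘ AffineMap.lineMap f g) := hφ.comp_affineMap _
  simpa [slope] using
    hconv.le_slope_of_hasDerivAt (Set.mem_univ 0) (Set.mem_univ 1) zero_lt_one hline

theorem gradient_eq_of_isMinOn_add_mul_norm_sq {φ : E → ℝ} {lam : ℝ} {a f : E}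
    (ha : HasGradientAt φ a f) (hf : IsMinOn (fun g => φ g + lam * ‖g‖ ^ 2) Set.univ f) :
    a = -(2 * lam) • f := by
  have hderiv := ha.hasFDerivAt.fun_add ((hasFDerivAt_id f).norm_sq.const_mul lam)
  have hzero := (hf.isLocalMin univ_mem).hasFDerivAt_eq_zero hderiv
  refine ext_inner_right ℝ fun v => ?_
  have hv := congr($hzero v)
  simp only [id_eq, ContinuousLinearMap.comp_id, add_apply, InnerProductSpace.toDual_apply_apply,
    smul_apply, coe_innerSL_apply, nsmul_eq_mul, Nat.cast_ofNat, smul_eq_mul, zero_apply,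
    neg_smul, inner_neg_left, real_inner_smul_left] at hv ⊢
  linarith

theorem mul_norm_sub_le_of_isMinOn_add_mul_norm_sq {φ ψ : E → ℝ} (hψ : ConvexOn ℝ Set.univ ψ)
    {lam : ℝ} {f g a b : E} (ha : HasGradientAt φ a f) (hb : HasGradientAt ψ b f)
    (hf : IsMinOn (fun h => φ h + lam * ‖h‖ ^ 2) Set.univ f)
    (hg : IsMinOn (fun h => ψ h + lam * ‖h‖ ^ 2) Set.univ g) :
    lam * ‖g - f‖ ≤ ‖b - a‖ := by
  have hmin : ψ g + lam * ‖g‖ ^ 2 ≤ ψ f + lam * ‖f‖ ^ 2 := hg trivial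
  have hnorm : ‖g‖ ^ 2 = ‖f‖ ^ 2 + 2 * inner ℝ f (g - f) + ‖g - f‖ ^ 2 := by
    rw [← norm_add_sq_real, add_sub_cancel]
  have hinner : inner ℝ a (g - f) = -(2 * lam) * inner ℝ f (g - f) := by
    rw [gradient_eq_of_isMinOn_add_mul_norm_sq ha hf, real_inner_smul_left]
  have hsq : (lam * ‖g - f‖) * ‖g - f‖ ≤ ‖b - a‖ * ‖g - f‖ := calc
    (lam * ‖g - f‖) * ‖g - f‖ ≤ inner ℝ (a - b) (g - f) := by
      rw [inner_sub_left, hinner]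
      linarith [inner_gradient_le_sub hψ hb g, congr(lam * $hnorm)]
    _ ≤ ‖b - a‖ * ‖g - f‖ := by
      rw [norm_sub_rev b a]
      exact real_inner_le_norm _ _
  rcases (norm_nonneg (g - f)).eq_or_lt with h0 | hpos
  · simp [← h0]
  · exact le_of_mul_le_mul_right hsq hpos

end ConvexOptimization

/-! ### Weak convergence of probability measures -/

section WeakConvergence

theorem measurable_empiricalMeasure_sample {Ω S : Type*} [MeasurableSpace Ω] [MeasurableSpace S]
    {Z : ℕ → Ω → S} (hZ : ∀ n, Measurable (Z n)) (n : ℕ) :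
    Measurable fun ω => empiricalMeasure (sample Z n ω) := by
  refine Measurable.subtype_mk (Measure.measurable_of_measurable_coe _ fun s hs => ?_)
  simp only [Measure.smul_apply, Measure.coe_finsetSum, Finset.sum_apply, smul_eq_mul]
  refine (Finset.measurable_fun_sum _ fun i _ => ?_).const_mul _
  exact (Measure.measurable_coe hs).comp (Measure.measurable_dirac.comp (hZ i))

theorem measurable_integral_probabilityMeasure {S : Type*} [MeasurableSpace S] {f : S → ℝ}
    (hf : Measurable f) : Measurable fun μ : ProbabilityMeasure S => ∫ s, f s ∂(μ : Measure S) := by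
  let κ : ProbabilityTheory.Kernel (ProbabilityMeasure S) S :=
    ⟨fun μ => (μ : Measure S), measurable_subtype_coe⟩
  exact (hf.stronglyMeasurable.integral_kernel (κ := κ)).measurable

theorem isOpen_setOf_lt_probabilityMeasure {S : Type*} [TopologicalSpace S] [HasOuterApproxClosed S]
    [MeasurableSpace S] [OpensMeasurableSpace S] {U : Set S} (hU : IsOpen U) (c : ℝ≥0∞) :
    IsOpen {μ : ProbabilityMeasure S | c < (μ : Measure S) U} :=
  isOpen_iff_eventually.mpr fun _ hμ => eventually_lt_of_lt_liminf
    (hμ.trans_le (ProbabilityMeasure.le_liminf_measure_open_of_tendsto tendsto_id hU))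

/-- A countable subbasis of the topology of weak convergence, when `S` is pseudometrizable: the sets
`{μ | q < μ U}` with `q` rational and `U` a finite union of elements of a countable basis of `S`. -/
def weakSubbasis (S : Type*) [TopologicalSpace S] [SecondCountableTopology S] [MeasurableSpace S] :
    Set (Set (ProbabilityMeasure S)) :=
  Set.range fun p : Finset (TopologicalSpace.countableBasis S) × ℚ =>
    {μ | ENNReal.ofReal p.2 < (μ : Measure S) (⋃ u ∈ p.1, (u : Set S))}

theorem isOpen_biUnion_countableBasis {S : Type*} [TopologicalSpace S] [SecondCountableTopology S]
    (T : Finset (TopologicalSpace.countableBasis S)) : IsOpen (⋃ u ∈ T, (u : Set S)) :=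
  isOpen_biUnion fun u _ => TopologicalSpace.isOpen_of_mem_countableBasis u.2

theorem exists_lt_measure_biUnion_countableBasis {S : Type*} [TopologicalSpace S]
    [SecondCountableTopology S] [MeasurableSpace S] (μ : ProbabilityMeasure S) {G : Set S}
    (hG : IsOpen G) {c : NNReal} (hc : c < μ G) :
    ∃ T : Finset (TopologicalSpace.countableBasis S),
      c < μ (⋃ u ∈ T, (u : Set S)) ∧ ⋃ u ∈ T, (u : Set S) ⊆ G := by
  classical
  obtain ⟨T, hT, hcT, hTG⟩ := μ.exists_lt_measure_biUnion_of_isOpen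
    (S := TopologicalSpace.countableBasis S) (fun U hU x hx => by
      obtain ⟨u, hu, hxu, huU⟩ :=
        (TopologicalSpace.isBasis_countableBasis S).exists_subset_of_mem_open hx hU
      exact ⟨u, hu, (TopologicalSpace.isOpen_of_mem_countableBasis hu).mem_nhds hxu, huU⟩) hG hc
  have hunion : ⋃ u ∈ T.subtype (· ∈ TopologicalSpace.countableBasis S), (u : Set S) =
      ⋃ u ∈ T, u := by
    ext x
    simp only [Set.mem_iUnion, Finset.mem_subtype, Subtype.exists, exists_prop]
    exact exists_congr fun u => ⟨fun h => h.2, fun h => ⟨hT u h.1, h⟩⟩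
  exact ⟨T.subtype _, by rwa [hunion], by rwa [hunion]⟩

variable {S : Type*} [TopologicalSpace S] [TopologicalSpace.PseudoMetrizableSpace S]
  [SecondCountableTopology S] [MeasurableSpace S] [OpensMeasurableSpace S]

theorem topology_probabilityMeasure_eq_generateFrom :
    (inferInstance : TopologicalSpace (ProbabilityMeasure S)) = .generateFrom (weakSubbasis S) := by
  refine le_antisymm (le_generateFrom ?_) ((le_iff_nhds _ _).mpr fun μ => ?_)
  · rintro _ ⟨p, rfl⟩
    exact isOpen_setOf_lt_probabilityMeasure (isOpen_biUnion_countableBasis p.1) _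
  have hcount : (@nhds _ (.generateFrom (weakSubbasis S)) μ).IsCountablyGenerated :=
    let _ := TopologicalSpace.generateFrom (weakSubbasis S)
    have : SecondCountableTopology (ProbabilityMeasure S) :=
      ⟨weakSubbasis S, Set.countable_range _, rfl⟩
    inferInstance
  refine tendsto_of_forall_isOpen_le_liminf' fun G hG => le_of_forall_lt fun c hc => ?_
  obtain ⟨q, -, hcq, hqG⟩ := ENNReal.lt_iff_exists_rat_btwn.mp hc
  obtain ⟨T, hqT, hTG⟩ := exists_lt_measure_biUnion_countableBasis μ hG (c := Real.toNNReal q)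
    (by rwa [← ENNReal.coe_lt_coe, ProbabilityMeasure.ennreal_coeFn_eq_coeFn_toMeasure])
  rw [← ENNReal.coe_lt_coe, ProbabilityMeasure.ennreal_coeFn_eq_coeFn_toMeasure] at hqT
  refine hcq.trans_le (le_liminf_of_le (by isBoundedDefault) ?_)
  have hopen : IsOpen[.generateFrom (weakSubbasis S)] {ν : ProbabilityMeasure S |
      ENNReal.ofReal q < (ν : Measure S) (⋃ u ∈ T, (u : Set S))} :=
    TopologicalSpace.isOpen_generateFrom_of_mem ⟨(T, q), rfl⟩
  filter_upwards [@IsOpen.mem_nhds _ (.generateFrom _) _ _ hopen hqT] with ν hν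
  exact hν.le.trans (measure_mono hTG)

theorem secondCountableTopology_probabilityMeasure :
    SecondCountableTopology (ProbabilityMeasure S) :=
  ⟨_, Set.countable_range _, topology_probabilityMeasure_eq_generateFrom⟩

theorem opensMeasurableSpace_probabilityMeasure :
    OpensMeasurableSpace (ProbabilityMeasure S) := by
  have := secondCountableTopology_probabilityMeasure (S := S)
  refine ⟨?_⟩
  rw [borel_eq_generateFrom_of_subbasis topology_probabilityMeasure_eq_generateFrom]
  refine MeasurableSpace.generateFrom_le ?_
  rintro _ ⟨p, rfl⟩
  exact measurableSet_lt measurable_const ((Measure.measurable_coe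
    (isOpen_biUnion_countableBasis p.1).measurableSet).comp measurable_subtype_coe)

theorem continuous_integral_probabilityMeasure {E : Type*}
    [NormedAddCommGroup E] [InnerProductSpace ℝ E] [CompleteSpace E] {Φ : S → E}
    (hΦ : Continuous Φ) {C : ℝ} (hC : ∀ s, ‖Φ s‖ ≤ C) :
    Continuous fun μ : ProbabilityMeasure S => ∫ s, Φ s ∂(μ : Measure S) := by
  have hint : ∀ μ : ProbabilityMeasure S, Integrable Φ (μ : Measure S) := fun μ =>
    .of_bound hΦ.aestronglyMeasurable C (.of_forall hC)
  -- The inner product of two integrals is the integral of a bounded continuous real function with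
  -- respect to a product measure, so its continuity is weak convergence of product measures.
  let k : S × S →ᵇ ℝ := .ofNormedAddCommGroup (fun p => inner ℝ (Φ p.1) (Φ p.2))
    (by fun_prop) (C * C) fun p => (norm_inner_le_norm _ _).trans
      (mul_le_mul (hC _) (hC _) (norm_nonneg _) ((norm_nonneg _).trans (hC p.1)))
  have hprod : ∀ p : ProbabilityMeasure S × ProbabilityMeasure S,
      ∫ s, k s ∂(p.1.prod p.2 : Measure (S × S)) =
        inner ℝ (∫ s, Φ s ∂(p.1 : Measure S)) (∫ s, Φ s ∂(p.2 : Measure S)) := fun p => by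
    rw [ProbabilityMeasure.toMeasure_prod, integral_prod _ (k.integrable _), real_inner_comm,
      ← integral_inner (hint _)]
    exact integral_congr_ae (.of_forall fun s => by
      simpa [k, real_inner_comm] using integral_inner (hint p.2) (Φ s))
  have hinner : Continuous fun p : ProbabilityMeasure S × ProbabilityMeasure S =>
      inner ℝ (∫ s, Φ s ∂(p.1 : Measure S)) (∫ s, Φ s ∂(p.2 : Measure S)) := by
    simp only [← hprod]
    exact (ProbabilityMeasure.continuous_integral_boundedContinuousFunction k).comp
      ProbabilityMeasure.continuous_prod
  refine continuous_iff_continuousAt.mpr fun μ => ?_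
  have hsq : Tendsto (fun ν : ProbabilityMeasure S =>
      ‖∫ s, Φ s ∂(ν : Measure S) - ∫ s, Φ s ∂(μ : Measure S)‖ ^ 2) (𝓝 μ) (𝓝 0) := by
    simp only [← real_inner_self_eq_norm_sq, inner_sub_left, inner_sub_right]
    refine Continuous.tendsto' ?_ _ _ (by ring)
    exact ((hinner.comp (continuous_id.prodMk continuous_id)).sub
      (hinner.comp (continuous_const.prodMk continuous_id))).sub
        ((hinner.comp (continuous_id.prodMk continuous_const)).sub continuous_const)
  rw [ContinuousAt, tendsto_iff_norm_sub_tendsto_zero]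
  simpa using hsq.sqrt

end WeakConvergence

/-! ### Diagonal sequences and convergence in probability -/

section DiagonalSequences

theorem exists_tendsto_atTop_eventually_diagonal {p : ℕ → ℕ → Prop}
    (hp : ∀ k, ∀ᶠ n in atTop, p k n) :
    ∃ κ : ℕ → ℕ, Tendsto κ atTop atTop ∧ ∀ᶠ n in atTop, p (κ n) n := by
  classical
  refine ⟨fun n => Nat.findGreatest (fun k => p k n) n, tendsto_atTop.mpr fun k => ?_, ?_⟩
  · filter_upwards [hp k, eventually_ge_atTop k] with n hn hkn
    exact Nat.le_findGreatest hkn hn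
  · filter_upwards [hp 0] with n hn
    exact Nat.findGreatest_spec (P := fun k => p k n) (Nat.zero_le n) hn

theorem tendstoInMeasure_comp_of_edist_le {Ω E E' ι : Type*} [MeasurableSpace Ω] {P : Measure Ω}
    [EDist E] [EDist E'] {l : Filter ι} {f : ι → Ω → E} {g : Ω → E} {φ : E → E'}
    (hφ : ∀ a b, edist (φ a) (φ b) ≤ edist a b) (hfg : TendstoInMeasure P f l g) :
    TendstoInMeasure P (fun i ω => φ (f i ω)) l fun ω => φ (g ω) := fun ε hε =>
  tendsto_of_tendsto_of_tendsto_of_le_of_le tendsto_const_nhds (hfg ε hε) (fun _ => zero_le)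
    fun _ => measure_mono fun _ hω => hω.trans (hφ _ _)

theorem edist_ofReal_ofReal_le (a b : ℝ) :
    edist (ENNReal.ofReal a) (ENNReal.ofReal b) ≤ edist a b := by
  have h := Real.lipschitzWith_toNNReal a b
  rwa [ENNReal.coe_one, one_mul] at h

variable {Ω E : Type*} [MeasurableSpace Ω] {P : Measure Ω} [PseudoEMetricSpace E]

theorem tendstoInMeasure_of_tendsto_measure_le_edist {ι : Type*} {l : Filter ι} {f g : ι → Ω → E}
    {h : Ω → E} (hfg : ∀ ε, 0 < ε → Tendsto (fun i => P {ω | ε ≤ edist (f i ω) (g i ω)}) l (𝓝 0))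
    (hgh : TendstoInMeasure P g l h) : TendstoInMeasure P f l h := fun ε hε => by
  have hε2 := ENNReal.half_pos hε.ne'
  refine tendsto_of_tendsto_of_tendsto_of_le_of_le tendsto_const_nhds
    (by simpa using (hfg _ hε2).add (hgh _ hε2)) (fun _ => zero_le) fun i => ?_
  refine (measure_mono fun ω (hω : ε ≤ edist (f i ω) (h ω)) => ?_).trans (measure_union_le _ _)
  by_contra! hlt
  simp only [Set.mem_union, Set.mem_ofPred_eq, not_or, not_le] at hlt
  exact hω.not_gt ((edist_triangle _ (g i ω) _).trans_lt
    ((ENNReal.add_lt_add hlt.1 hlt.2).trans_eq (ENNReal.add_halves ε)))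

theorem exists_tendsto_atTop_tendstoInMeasure_diagonal {F : ℕ → ℕ → Ω → E} {g : ℕ → Ω → E}
    {h : Ω → E} (hF : ∀ k, TendstoInMeasure P (F k) atTop (g k))
    (hg : TendstoInMeasure P g atTop h) :
    ∃ κ : ℕ → ℕ, Tendsto κ atTop atTop ∧ TendstoInMeasure P (fun n => F (κ n) n) atTop h := by
  obtain ⟨u, -, hu_mem, hu⟩ := exists_seq_strictAnti_tendsto' (zero_lt_one (α := ℝ≥0∞))
  obtain ⟨κ, hκ, hFκ⟩ := exists_tendsto_atTop_eventually_diagonal fun k =>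
    (hF k (u k) (hu_mem k).1).eventually_le_const (hu_mem k).1
  refine ⟨κ, hκ, tendstoInMeasure_of_tendsto_measure_le_edist (fun ε hε => ?_) (hg.comp hκ)⟩
  refine tendsto_of_tendsto_of_tendsto_of_le_of_le' tendsto_const_nhds (hu.comp hκ)
    (.of_forall fun _ => zero_le) ?_
  filter_upwards [hFκ, (hu.comp hκ).eventually_le_const hε] with n hn hun
  exact (measure_mono fun ω hω => hun.trans hω).trans hn

theorem exists_tendsto_atTop_ae_tendsto_diagonal [IsFiniteMeasure P] {F : ℕ → ℕ → Ω → E}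
    {g : ℕ → Ω → E} {h : Ω → E} (hF_meas : ∀ k n, StronglyMeasurable (F k n))
    (hg_meas : ∀ k, StronglyMeasurable (g k))
    (hF : ∀ k, ∀ᵐ ω ∂P, Tendsto (fun n => F k n ω) atTop (𝓝 (g k ω)))
    (hg : ∀ᵐ ω ∂P, Tendsto (fun k => g k ω) atTop (𝓝 (h ω))) :
    ∃ κ : ℕ → ℕ, Tendsto κ atTop atTop ∧
      ∀ᵐ ω ∂P, Tendsto (fun n => F (κ n) n ω) atTop (𝓝 (h ω)) := by
  obtain ⟨u, -, hu_mem, hu⟩ := exists_seq_strictAnti_tendsto' (zero_lt_one (α := ℝ≥0∞))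
  have hpow : ∀ k, (0 : ℝ) < 2⁻¹ ^ k := fun k => by positivity
  choose t _ ht_measure ht using fun k =>
    tendstoUniformlyOn_of_ae_tendsto' (hF_meas k) (hg_meas k) (hF k) (hpow k)
  obtain ⟨κ, hκ, hFκ⟩ := exists_tendsto_atTop_eventually_diagonal fun k =>
    EMetric.tendstoUniformlyOn_iff.mp (ht k) (u k) (hu_mem k).1
  have hsum : ∑' k, P (t k) ≠ ∞ := by
    refine ne_top_of_le_ne_top ?_ (ENNReal.tsum_le_tsum ht_measure)
    rw [← ENNReal.ofReal_tsum_of_nonneg (fun k => (hpow k).le)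
      (summable_geometric_of_lt_one (by norm_num) (by norm_num))]
    exact ENNReal.ofReal_ne_top
  refine ⟨κ, hκ, ?_⟩
  filter_upwards [hg, ae_eventually_notMem hsum] with ω hgω htω
  rw [tendsto_iff_edist_tendsto_0]
  refine tendsto_of_tendsto_of_tendsto_of_le_of_le' tendsto_const_nhds
    (by simpa using (hu.comp hκ).add ((tendsto_iff_edist_tendsto_0.mp hgω).comp hκ))
    (.of_forall fun _ => zero_le) ?_
  filter_upwards [hFκ, hκ.eventually htω] with n hn hωn
  refine (edist_triangle _ (g (κ n) ω) _).trans (add_le_add_left ?_ _)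
  rw [edist_comm]
  exact (hn ω hωn).le

end DiagonalSequences

section ConvergenceInProbability

variable {Ω M : Type*} [MeasurableSpace Ω] [TopologicalSpace M] {P : Measure Ω}

/-- Every subsequence of `η` has a further subsequence that converges almost surely to `J`: the
metric-free form of convergence in probability. -/
def SubseqTendstoAE (P : Measure Ω) (η : ℕ → Ω → M) (J : Ω → M) : Prop :=
  ∀ ns : ℕ → ℕ, StrictMono ns → ∃ ns' : ℕ → ℕ, StrictMono ns' ∧
    ∀ᵐ ω ∂P, Tendsto (fun i => η (ns (ns' i)) ω) atTop (𝓝 (J ω))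

theorem IsEWCInProb.subseqTendstoAE {S : Type*} [MeasurableSpace S] [TopologicalSpace S]
    [OpensMeasurableSpace S] {Z : ℕ → Ω → S} {J : Ω → ProbabilityMeasure S}
    (h : IsEWCInProb P Z J) :
    SubseqTendstoAE P (fun n ω => empiricalMeasure (sample Z n ω)) J := by
  obtain ⟨d, hd, hlim⟩ := h.tendsto
  intro ns hns
  obtain ⟨ns', hns', hae⟩ :=
    ((tendstoInMeasure_iff_dist.mpr hlim).comp hns.tendsto_atTop).exists_seq_tendsto_ae
  refine ⟨ns', hns', ?_⟩
  filter_upwards [hae] with ω hω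
  rwa [hd] at hω

theorem SubseqTendstoAE.tendstoInMeasure_comp {E : Type*} [PseudoEMetricSpace E]
    [IsFiniteMeasure P] {η : ℕ → Ω → M} {J : Ω → M} (h : SubseqTendstoAE P η J)
    {g : Ω → M → E} (hg : ∀ ω, ContinuousAt (g ω) (J ω))
    (hmeas : ∀ n, AEStronglyMeasurable (fun ω => g ω (η n ω)) P) :
    TendstoInMeasure P (fun n ω => g ω (η n ω)) atTop fun ω => g ω (J ω) := by
  refine (exists_seq_tendstoInMeasure_atTop_iff hmeas).mpr fun ns hns => ?_
  obtain ⟨ns', hns', hae⟩ := h ns hns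
  refine ⟨ns', hns', ?_⟩
  filter_upwards [hae] with ω hω
  exact (hg ω).tendsto.comp hω

end ConvergenceInProbability

/-! ### Regularized expected losses -/

/-- The nonnegative functions `ℓ s` on a Hilbert space are convex and differentiable, have gradients
depending continuously on the parameter `s`, and are bounded at the origin and Lipschitz on balls
uniformly in `s`. Unlike the loss `L x y` of a value, `ℓ s` is the loss of a hypothesis: in the
application `ℓ (x, y) f = L x y (f x)`. -/
structure IsSmoothConvexIntegrand {S E : Type*} [TopologicalSpace S] [MeasurableSpace S]
    [NormedAddCommGroup E] [InnerProductSpace ℝ E] [CompleteSpace E] (ℓ : S → E → ℝ) : Prop where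
  nonneg : ∀ s f, 0 ≤ ℓ s f
  measurable : ∀ f, Measurable fun s => ℓ s f
  convexOn : ∀ s, ConvexOn ℝ Set.univ (ℓ s)
  differentiable : ∀ s, Differentiable ℝ (ℓ s)
  continuous_gradient : ∀ f, Continuous fun s => gradient (ℓ s) f
  bounded_zero : ∃ B, ∀ s, ℓ s 0 ≤ B
  lipschitzOnWith_closedBall : ∀ r, ∃ M, ∀ s, LipschitzOnWith M (ℓ s) (Metric.closedBall 0 r)

/-- The expectation of the loss `ℓ s f` of `f` for random `s` with distribution `μ`; it is `0` when
the loss is not integrable. -/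
def expectedLoss {S E : Type*} [MeasurableSpace S] (ℓ : S → E → ℝ) (μ : ProbabilityMeasure S)
    (f : E) : ℝ :=
  ∫ s, ℓ s f ∂(μ : Measure S)

/-- The minimizer of the regularized expected loss (an arbitrary element if there is none). -/
def regularizedMinimizer {S E : Type*} [MeasurableSpace S] [NormedAddCommGroup E] (ℓ : S → E → ℝ)
    (lam : ℝ) (μ : ProbabilityMeasure S) : E :=
  Classical.epsilon (IsMinOn (fun f => expectedLoss ℓ μ f + lam * ‖f‖ ^ 2) Set.univ)

namespace IsSmoothConvexIntegrand

variable {S E : Type*} [TopologicalSpace S] [MeasurableSpace S] [NormedAddCommGroup E]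
  [InnerProductSpace ℝ E] [CompleteSpace E] {ℓ : S → E → ℝ} {lam : ℝ}

theorem exists_norm_le (hℓ : IsSmoothConvexIntegrand ℓ) (f : E) : ∃ C, ∀ s, ‖ℓ s f‖ ≤ C := by
  obtain ⟨B, hB⟩ := hℓ.bounded_zero
  obtain ⟨M, hM⟩ := hℓ.lipschitzOnWith_closedBall ‖f‖
  refine ⟨B + M * ‖f‖, fun s => ?_⟩
  have hdist := (hM s).dist_le_mul f (by simp) 0 (by simp)
  rw [Real.dist_eq, dist_zero_right] at hdist
  rw [Real.norm_of_nonneg (hℓ.nonneg s f)]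
  linarith [le_abs_self (ℓ s f - ℓ s 0), hB s]

theorem integrable (hℓ : IsSmoothConvexIntegrand ℓ) (μ : ProbabilityMeasure S) (f : E) :
    Integrable (fun s => ℓ s f) (μ : Measure S) :=
  let ⟨C, hC⟩ := hℓ.exists_norm_le f
  .of_bound (hℓ.measurable f).aestronglyMeasurable C (.of_forall hC)

theorem expectedLoss_nonneg (hℓ : IsSmoothConvexIntegrand ℓ) (μ : ProbabilityMeasure S) (f : E) :
    0 ≤ expectedLoss ℓ μ f :=
  integral_nonneg fun s => hℓ.nonneg s f

theorem bddBelow_range_expectedLoss (hℓ : IsSmoothConvexIntegrand ℓ) (μ : ProbabilityMeasure S) :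
    BddBelow (Set.range (expectedLoss ℓ μ)) :=
  ⟨0, Set.forall_mem_range.mpr (hℓ.expectedLoss_nonneg μ)⟩

theorem convexOn_expectedLoss (hℓ : IsSmoothConvexIntegrand ℓ) (μ : ProbabilityMeasure S) :
    ConvexOn ℝ Set.univ (expectedLoss ℓ μ) :=
  integral_convexOn_of_integrand_ae convex_univ (.of_forall hℓ.convexOn) fun f _ =>
    hℓ.integrable μ f

theorem exists_norm_gradient_le (hℓ : IsSmoothConvexIntegrand ℓ) (f : E) :
    ∃ C, ∀ s, ‖gradient (ℓ s) f‖ ≤ C := by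
  obtain ⟨M, hM⟩ := hℓ.lipschitzOnWith_closedBall (‖f‖ + 1)
  refine ⟨M, fun s => ?_⟩
  rw [← (InnerProductSpace.toDual ℝ E).norm_map]
  exact (hℓ.differentiable s f).hasGradientAt.hasFDerivAt.le_of_lipschitzOn
    (Metric.closedBall_mem_nhds_of_mem (by simp)) (hM s)

variable [SecondCountableTopology S] [OpensMeasurableSpace S]

theorem hasGradientAt_expectedLoss (hℓ : IsSmoothConvexIntegrand ℓ)
    (μ : ProbabilityMeasure S) (f : E) :
    HasGradientAt (expectedLoss ℓ μ) (∫ s, gradient (ℓ s) f ∂(μ : Measure S)) f := by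
  obtain ⟨M, hM⟩ := hℓ.lipschitzOnWith_closedBall (‖f‖ + 1)
  obtain ⟨C, hC⟩ := hℓ.exists_norm_gradient_le f
  have hgrad := (hℓ.continuous_gradient f).aestronglyMeasurable (μ := (μ : Measure S))
  have hcomm : ∫ s, InnerProductSpace.toDual ℝ E (gradient (ℓ s) f) ∂(μ : Measure S) =
      InnerProductSpace.toDual ℝ E (∫ s, gradient (ℓ s) f ∂(μ : Measure S)) :=
    (InnerProductSpace.toDual ℝ E).toContinuousLinearEquiv.toContinuousLinearMap.integral_comp_comm
      (.of_bound hgrad C (.of_forall hC))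
  rw [hasGradientAt_iff_hasFDerivAt, ← hcomm]
  exact (hasFDerivAt_integral_of_dominated_loc_of_lip (F := fun f s => ℓ s f) (bound := fun _ => M)
    (Metric.closedBall_mem_nhds_of_mem (c := (0 : E)) (ε := ‖f‖ + 1) (by simp))
    (.of_forall fun g => (hℓ.measurable g).aestronglyMeasurable) (hℓ.integrable μ f)
    ((LinearIsometryEquiv.continuous _).comp_aestronglyMeasurable hgrad)
    (.of_forall fun s => by simpa using hM s) (integrable_const _)
    (.of_forall fun s => (hℓ.differentiable s f).hasGradientAt.hasFDerivAt)).2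

theorem continuous_expectedLoss (hℓ : IsSmoothConvexIntegrand ℓ) (μ : ProbabilityMeasure S) :
    Continuous (expectedLoss ℓ μ) :=
  continuous_iff_continuousAt.mpr fun f =>
    (hℓ.hasGradientAt_expectedLoss μ f).hasFDerivAt.continuousAt

theorem existsUnique_isMinOn_regularized (hℓ : IsSmoothConvexIntegrand ℓ) (hlam : 0 < lam)
    (μ : ProbabilityMeasure S) :
    ∃! f, IsMinOn (fun f => expectedLoss ℓ μ f + lam * ‖f‖ ^ 2) Set.univ f := by
  refine existsUnique_isMinOn_of_strongConvexOn (m := 2 * lam) (by positivity)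
    (strongConvexOn_add_mul_norm_sq (hℓ.convexOn_expectedLoss μ) lam)
    ((hℓ.continuous_expectedLoss μ).add (by fun_prop)) ⟨0, Set.forall_mem_range.mpr fun f => ?_⟩
  exact add_nonneg (hℓ.expectedLoss_nonneg μ f) (by positivity)

theorem isMinOn_regularizedMinimizer (hℓ : IsSmoothConvexIntegrand ℓ) (hlam : 0 < lam)
    (μ : ProbabilityMeasure S) :
    IsMinOn (fun f => expectedLoss ℓ μ f + lam * ‖f‖ ^ 2) Set.univ
      (regularizedMinimizer ℓ lam μ) :=
  Classical.epsilon_spec (hℓ.existsUnique_isMinOn_regularized hlam μ).exists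

theorem tendsto_expectedLoss_regularizedMinimizer {ι : Type*} {l : Filter ι} {lam : ι → ℝ}
    (hℓ : IsSmoothConvexIntegrand ℓ) (hpos : ∀ i, 0 < lam i) (hlam : Tendsto lam l (𝓝 0))
    (μ : ProbabilityMeasure S) :
    Tendsto (fun i => expectedLoss ℓ μ (regularizedMinimizer ℓ (lam i) μ)) l
      (𝓝 (⨅ f, expectedLoss ℓ μ f)) :=
  tendsto_of_isMinOn_add_mul_norm_sq (hℓ.bddBelow_range_expectedLoss μ) (fun i => (hpos i).le) hlam
    fun i => hℓ.isMinOn_regularizedMinimizer (hpos i) μ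

variable [TopologicalSpace.PseudoMetrizableSpace S]

theorem continuous_regularizedMinimizer (hℓ : IsSmoothConvexIntegrand ℓ) (hlam : 0 < lam) :
    Continuous (regularizedMinimizer ℓ lam) := by
  refine continuous_iff_continuousAt.mpr fun μ => ?_
  set f := regularizedMinimizer ℓ lam μ
  obtain ⟨C, hC⟩ := hℓ.exists_norm_gradient_le f
  have hgrad := ((continuous_integral_probabilityMeasure (hℓ.continuous_gradient f) hC).tendsto μ)
  rw [ContinuousAt, tendsto_iff_norm_sub_tendsto_zero]
  refine squeeze_zero (fun _ => norm_nonneg _) (fun ν => ?_)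
    (by simpa using (tendsto_iff_norm_sub_tendsto_zero.mp hgrad).const_mul lam⁻¹)
  rw [← div_eq_inv_mul, le_div_iff₀' hlam]
  exact mul_norm_sub_le_of_isMinOn_add_mul_norm_sq (hℓ.convexOn_expectedLoss ν)
    (hℓ.hasGradientAt_expectedLoss μ f) (hℓ.hasGradientAt_expectedLoss ν f)
    (hℓ.isMinOn_regularizedMinimizer hlam μ) (hℓ.isMinOn_regularizedMinimizer hlam ν)

theorem continuous_expectedLoss_regularizedMinimizer (hℓ : IsSmoothConvexIntegrand ℓ)
    (hlam : 0 < lam) (ν : ProbabilityMeasure S) :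
    Continuous fun μ => expectedLoss ℓ ν (regularizedMinimizer ℓ lam μ) :=
  (hℓ.continuous_expectedLoss ν).comp (hℓ.continuous_regularizedMinimizer hlam)

end IsSmoothConvexIntegrand

namespace IsSmoothConvexIntegrand

variable {S E Ω : Type*} [TopologicalSpace S] [TopologicalSpace.PseudoMetrizableSpace S]
  [SecondCountableTopology S] [MeasurableSpace S] [BorelSpace S] [NormedAddCommGroup E]
  [InnerProductSpace ℝ E] [CompleteSpace E] [MeasurableSpace Ω] {ℓ : S → E → ℝ}

theorem measurable_expectedLoss_regularizedMinimizer {lam : ℝ} (hℓ : IsSmoothConvexIntegrand ℓ)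
    (hlam : 0 < lam) {μ ν : Ω → ProbabilityMeasure S} (hμ : Measurable μ) (hν : Measurable ν) :
    Measurable fun ω => expectedLoss ℓ (ν ω) (regularizedMinimizer ℓ lam (μ ω)) := by
  have := secondCountableTopology_probabilityMeasure (S := S)
  have := opensMeasurableSpace_probabilityMeasure (S := S)
  exact (measurable_uncurry_of_continuous_of_measurable
    (u := fun μ ν => expectedLoss ℓ ν (regularizedMinimizer ℓ lam μ))
    (hℓ.continuous_expectedLoss_regularizedMinimizer hlam)
    fun μ => measurable_integral_probabilityMeasure (hℓ.measurable _)).comp (hμ.prodMk hν)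

variable {P : Measure Ω} [IsFiniteMeasure P] {lam : ℕ → ℝ}
  {η : ℕ → Ω → ProbabilityMeasure S} {J : Ω → ProbabilityMeasure S}

theorem exists_tendstoInMeasure_expectedLoss_regularizedMinimizer
    (hℓ : IsSmoothConvexIntegrand ℓ) (hpos : ∀ k, 0 < lam k) (hlam : Tendsto lam atTop (𝓝 0))
    (hη_meas : ∀ n, Measurable (η n)) (hJ_meas : Measurable J) (hη : SubseqTendstoAE P η J) :
    ∃ κ : ℕ → ℕ, Tendsto κ atTop atTop ∧ TendstoInMeasure P
      (fun n ω => expectedLoss ℓ (J ω) (regularizedMinimizer ℓ (lam (κ n)) (η n ω))) atTop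
      fun ω => ⨅ f, expectedLoss ℓ (J ω) f :=
  exists_tendsto_atTop_tendstoInMeasure_diagonal
    (F := fun k n ω => expectedLoss ℓ (J ω) (regularizedMinimizer ℓ (lam k) (η n ω)))
    (fun k => hη.tendstoInMeasure_comp
      (g := fun ω μ => expectedLoss ℓ (J ω) (regularizedMinimizer ℓ (lam k) μ))
      (fun ω => (hℓ.continuous_expectedLoss_regularizedMinimizer (hpos k) (J ω)).continuousAt)
      fun n => (hℓ.measurable_expectedLoss_regularizedMinimizer (hpos k) (hη_meas n)
        hJ_meas).aestronglyMeasurable)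
    (tendstoInMeasure_of_tendsto_ae
      (fun k => (hℓ.measurable_expectedLoss_regularizedMinimizer (hpos k) hJ_meas
        hJ_meas).aestronglyMeasurable)
      (.of_forall fun ω => hℓ.tendsto_expectedLoss_regularizedMinimizer hpos hlam (J ω)))

theorem exists_ae_tendsto_expectedLoss_regularizedMinimizer
    (hℓ : IsSmoothConvexIntegrand ℓ) (hpos : ∀ k, 0 < lam k) (hlam : Tendsto lam atTop (𝓝 0))
    (hη_meas : ∀ n, Measurable (η n)) (hJ_meas : Measurable J)
    (hη : ∀ᵐ ω ∂P, Tendsto (fun n => η n ω) atTop (𝓝 (J ω))) :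
    ∃ κ : ℕ → ℕ, Tendsto κ atTop atTop ∧ ∀ᵐ ω ∂P, Tendsto
      (fun n => expectedLoss ℓ (J ω) (regularizedMinimizer ℓ (lam (κ n)) (η n ω))) atTop
      (𝓝 (⨅ f, expectedLoss ℓ (J ω) f)) :=
  exists_tendsto_atTop_ae_tendsto_diagonal
    (F := fun k n ω => expectedLoss ℓ (J ω) (regularizedMinimizer ℓ (lam k) (η n ω)))
    (fun k n => (hℓ.measurable_expectedLoss_regularizedMinimizer (hpos k) (hη_meas n)
      hJ_meas).stronglyMeasurable)
    (fun k => (hℓ.measurable_expectedLoss_regularizedMinimizer (hpos k) hJ_meas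
      hJ_meas).stronglyMeasurable)
    (fun k => hη.mono fun ω hω =>
      ((hℓ.continuous_expectedLoss_regularizedMinimizer (hpos k) (J ω)).tendsto _).comp hω)
    (.of_forall fun ω => hℓ.tendsto_expectedLoss_regularizedMinimizer hpos hlam (J ω))

end IsSmoothConvexIntegrand

/-! ### Support vector machines -/

section SupportVectorMachine

variable {X Y G H : Type*} [NormedAddCommGroup G] [InnerProductSpace ℝ G] [NormedAddCommGroup H]
  [InnerProductSpace ℝ H] [RKHS ℝ H X G] {L : X → Y → G → ℝ}

variable (H) in
/-- The loss of the hypothesis `f ∈ H` at the observation `p = (x, y)`: the loss `L x y` of the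
value `f x`. -/
def pointwiseLoss (L : X → Y → G → ℝ) (p : X × Y) (f : H) : ℝ :=
  L p.1 p.2 (f p.1)

theorem convexOn_pointwiseLoss (hconvex : IsConvexLoss L) (p : X × Y) :
    ConvexOn ℝ Set.univ (pointwiseLoss H L p) := by
  refine ⟨convex_univ, fun f _ g _ a b ha hb hab => ?_⟩
  simpa only [pointwiseLoss, RKHS.coe_add, RKHS.coe_smul, Pi.add_apply, Pi.smul_apply] using
    (hconvex p.1 p.2).2 (Set.mem_univ (f p.1)) (Set.mem_univ (g p.1)) ha hb hab

theorem measurable_pointwiseLoss [MeasurableSpace X] [MeasurableSpace Y] [MeasurableSpace G]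
    (hL : IsLoss L) {f : H} (hf : Measurable (f : X → G)) :
    Measurable fun p : X × Y => pointwiseLoss H L p f :=
  hL.measurable.comp
    (measurable_fst.prodMk (measurable_snd.prodMk (hf.comp measurable_fst)))

variable [CompleteSpace H]

section Kernel

variable [CompleteSpace G]

theorem lipschitzOnWith_pointwiseLoss
    (hbdd : BddAbove (Set.range fun x : X => Real.sqrt ‖RKHS.kernel H x x‖))
    (hlip : IsLocallyLipschitzLoss L) (r : ℝ) :
    ∃ M, ∀ p : X × Y, LipschitzOnWith M (pointwiseLoss H L p) (Metric.closedBall 0 r) := by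
  obtain ⟨κ, hκ⟩ := hbdd
  have heval : ∀ (f : H) x, ‖f x‖ ≤ ‖f‖ * κ := fun f x => (RKHS.norm_apply_le f x).trans
    (mul_le_mul_of_nonneg_left (hκ ⟨x, rfl⟩) (norm_nonneg f))
  obtain ⟨M, hM⟩ := hlip (max (r * κ) 1) (by positivity)
  refine ⟨M.toNNReal * κ.toNNReal, fun p => .of_dist_le_mul fun f hf g hg => ?_⟩
  have hκ0 : 0 ≤ κ := (Real.sqrt_nonneg _).trans (hκ ⟨p.1, rfl⟩)
  have hball : ∀ f ∈ Metric.closedBall (0 : H) r, ‖f p.1‖ ≤ max (r * κ) 1 := fun f hf =>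
    ((heval f p.1).trans (mul_le_mul_of_nonneg_right (mem_closedBall_zero_iff.mp hf) hκ0)).trans
      (le_max_left _ _)
  rw [dist_eq_norm f g, Real.dist_eq, NNReal.coe_mul, Real.coe_toNNReal κ hκ0]
  calc |L p.1 p.2 (f p.1) - L p.1 p.2 (g p.1)|
      ≤ M * ‖f p.1 - g p.1‖ := hM p.1 p.2 _ _ (hball f hf) (hball g hg)
    _ ≤ M.toNNReal * ‖(f - g) p.1‖ := by
      rw [RKHS.coe_sub, Pi.sub_apply]
      gcongr
      exact Real.le_coe_toNNReal M
    _ ≤ M.toNNReal * (‖f - g‖ * κ) := by gcongr; exact heval _ _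
    _ = M.toNNReal * κ * ‖f - g‖ := by ring

theorem hasGradientAt_pointwiseLoss {p : X × Y} (hdiff : Differentiable ℝ (L p.1 p.2)) (f : H) :
    HasGradientAt (pointwiseLoss H L p)
      (RKHS.kerFun H p.1 (gradient (L p.1 p.2) (f p.1))) f := by
  rw [hasGradientAt_iff_hasFDerivAt]
  refine ((hdiff (f p.1)).hasGradientAt.hasFDerivAt.comp f
    (((ContinuousLinearMap.proj p.1).comp (RKHS.coeCLM ℝ)).hasFDerivAt)).congr_fderiv ?_
  ext g
  simp

theorem isSmoothConvexIntegrand_pointwiseLoss [TopologicalSpace X] [MeasurableSpace X]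
    [OpensMeasurableSpace X] [TopologicalSpace Y] [MeasurableSpace Y] [MeasurableSpace G]
    [BorelSpace G] (hcont : ∀ f : H, Continuous (f : X → G))
    (hbdd : BddAbove (Set.range fun x : X => Real.sqrt ‖RKHS.kernel H x x‖))
    (hfeature : Continuous fun x : X => RKHS.kerFun H x) (hL : IsLoss L)
    (hconvex : IsConvexLoss L) (hdiff : IsContDiffLoss L) (hlip : IsLocallyLipschitzLoss L)
    (hlocbdd : IsLocallyBoundedLoss L) :
    IsSmoothConvexIntegrand (pointwiseLoss H L) where
  nonneg p f := hL.nonneg p.1 p.2 (f p.1)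
  measurable f := measurable_pointwiseLoss hL (hcont f).measurable
  convexOn := convexOn_pointwiseLoss hconvex
  differentiable p f :=
    (hasGradientAt_pointwiseLoss (hdiff.differentiable p.1 p.2) f).hasFDerivAt.differentiableAt
  continuous_gradient f := by
    simp only [fun p : X × Y =>
      (hasGradientAt_pointwiseLoss (hdiff.differentiable p.1 p.2) f).gradient]
    exact (hfeature.comp continuous_fst).clm_apply (hdiff.continuous_gradient.comp
      (continuous_fst.prodMk (continuous_snd.prodMk ((hcont f).comp continuous_fst))))
  bounded_zero := by
    obtain ⟨M, hM⟩ := hlocbdd {0} Bornology.isBounded_singleton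
    exact ⟨M, fun p => (le_abs_self _).trans (hM p.1 p.2 _ (by simp))⟩
  lipschitzOnWith_closedBall := lipschitzOnWith_pointwiseLoss hbdd hlip

end Kernel

section Risk

variable [TopologicalSpace X] [MeasurableSpace X] [TopologicalSpace Y] [MeasurableSpace Y]

theorem risk_eq_ofReal_expectedLoss (hℓ : IsSmoothConvexIntegrand (pointwiseLoss H L))
    (μ : ProbabilityMeasure (X × Y)) (f : H) :
    risk L μ f = ENNReal.ofReal (expectedLoss (pointwiseLoss H L) μ f) :=
  (ofReal_integral_eq_lintegral_ofReal (hℓ.integrable μ f)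
    (.of_forall fun p => hℓ.nonneg p f)).symm

theorem bayesRisk_eq_ofReal_iInf_expectedLoss [MeasurableSpace G]
    (hℓ : IsSmoothConvexIntegrand (pointwiseLoss H L)) {μ : ProbabilityMeasure (X × Y)}
    (hrich : IsRich (Set.range fun f : H => (f : X → G)) L μ) :
    bayesRisk L μ = ENNReal.ofReal (⨅ f : H, expectedLoss (pointwiseLoss H L) μ f) := by
  rw [← hrich, iInf_range, ENNReal.ofReal_iInf]
  exact iInf_congr (risk_eq_ofReal_expectedLoss hℓ μ)

variable {lam : ℝ} {n : ℕ} {z : Fin (n + 1) → X × Y}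

theorem isSVMSolution_iff_isMinOn (hℓ : IsSmoothConvexIntegrand (pointwiseLoss H L))
    (hlam : 0 < lam) (f : H) :
    IsSVMSolution L lam z f ↔ IsMinOn
      (fun f => expectedLoss (pointwiseLoss H L) (empiricalMeasure z) f + lam * ‖f‖ ^ 2)
      Set.univ f := by
  have hnonneg : ∀ g : H, 0 ≤ lam * ‖g‖ ^ 2 := fun g => by positivity
  have hregularized : ∀ g : H, regularizedRisk L lam z g = ENNReal.ofReal
      (expectedLoss (pointwiseLoss H L) (empiricalMeasure z) g + lam * ‖g‖ ^ 2) := fun g => by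
    rw [regularizedRisk, risk_eq_ofReal_expectedLoss hℓ,
      ENNReal.ofReal_add (hℓ.expectedLoss_nonneg _ g) (hnonneg g)]
  simp only [IsSVMSolution, isMinOn_univ_iff, hregularized, ENNReal.ofReal_le_ofReal_iff
    (add_nonneg (hℓ.expectedLoss_nonneg _ _) (hnonneg _))]

theorem svmSolution_eq_regularizedMinimizer (hℓ : IsSmoothConvexIntegrand (pointwiseLoss H L))
    (hlam : 0 < lam) :
    svmSolution H L lam z = regularizedMinimizer (pointwiseLoss H L) lam (empiricalMeasure z) :=
  congrArg Classical.epsilon (funext fun f => propext (isSVMSolution_iff_isMinOn hℓ hlam f))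

theorem existsUnique_isSVMSolution [SecondCountableTopology (X × Y)]
    [OpensMeasurableSpace (X × Y)] (hℓ : IsSmoothConvexIntegrand (pointwiseLoss H L))
    (hlam : 0 < lam) : ∃! f : H, IsSVMSolution L lam z f := by
  simp only [isSVMSolution_iff_isMinOn hℓ hlam]
  exact hℓ.existsUnique_isMinOn_regularized hlam (empiricalMeasure z)

end Risk

section Consistency

variable [TopologicalSpace X] [TopologicalSpace.PseudoMetrizableSpace X]
  [SecondCountableTopology X] [MeasurableSpace X] [BorelSpace X] [TopologicalSpace Y]
  [TopologicalSpace.PseudoMetrizableSpace Y] [SecondCountableTopology Y] [MeasurableSpace Y]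
  [BorelSpace Y] [MeasurableSpace G] {Ω : Type*} [MeasurableSpace Ω] {P : Measure Ω}
  [IsFiniteMeasure P] {Z : ℕ → Ω → X × Y} {J : Ω → ProbabilityMeasure (X × Y)} {lam : ℕ → ℝ}

theorem exists_isConsistent_svm (hmeas : ∀ f : H, Measurable (f : X → G))
    (hℓ : IsSmoothConvexIntegrand (pointwiseLoss H L)) (hpos : ∀ k, 0 < lam k)
    (hlam : Tendsto lam atTop (𝓝 0))
    (hrich : ∀ᵐ ω ∂P, IsRich (Set.range fun f : H => (f : X → G)) L (J ω))
    (hZ : IsEWCInProb P Z J) :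
    ∃ κ : ℕ → ℕ, Tendsto κ atTop atTop ∧ IsConsistent P L (svm H hmeas L (lam ∘ κ)) Z J := by
  obtain ⟨κ, hκ, hconv⟩ := hℓ.exists_tendstoInMeasure_expectedLoss_regularizedMinimizer hpos hlam
    (measurable_empiricalMeasure_sample hZ.measurable_process) hZ.measurable_limit
    hZ.subseqTendstoAE
  refine ⟨κ, hκ, (tendstoInMeasure_comp_of_edist_le edist_ofReal_ofReal_le hconv).congr
    (fun n => .of_forall fun ω => ?_) ?_⟩
  · simp only [svm, Function.comp_apply, risk_eq_ofReal_expectedLoss hℓ,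
      svmSolution_eq_regularizedMinimizer hℓ (hpos _)]
  · exact hrich.mono fun ω hω => (bayesRisk_eq_ofReal_iInf_expectedLoss hℓ hω).symm

theorem exists_isStronglyConsistent_svm (hmeas : ∀ f : H, Measurable (f : X → G))
    (hℓ : IsSmoothConvexIntegrand (pointwiseLoss H L)) (hpos : ∀ k, 0 < lam k)
    (hlam : Tendsto lam atTop (𝓝 0))
    (hrich : ∀ᵐ ω ∂P, IsRich (Set.range fun f : H => (f : X → G)) L (J ω))
    (hZ : IsEWCAlmostSurely P Z J) :
    ∃ κ : ℕ → ℕ, Tendsto κ atTop atTop ∧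
      IsStronglyConsistent P L (svm H hmeas L (lam ∘ κ)) Z J := by
  obtain ⟨κ, hκ, hconv⟩ := hℓ.exists_ae_tendsto_expectedLoss_regularizedMinimizer hpos hlam
    (measurable_empiricalMeasure_sample hZ.measurable_process) hZ.measurable_limit hZ.tendsto
  refine ⟨κ, hκ, ?_⟩
  filter_upwards [hconv, hrich] with ω hω hrichω
  simp only [svm, Function.comp_apply, risk_eq_ofReal_expectedLoss hℓ,
    svmSolution_eq_regularizedMinimizer hℓ (hpos _),
    bayesRisk_eq_ofReal_iInf_expectedLoss hℓ hrichω]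
  exact (ENNReal.continuous_ofReal.tendsto _).comp hω

end Consistency

end SupportVectorMachine

theorem mainTheorem1_general {Ω : Type*} [MeasurableSpace Ω] (P : Measure Ω) [IsFiniteMeasure P]
    {X Y : Type*} [TopologicalSpace X] [TopologicalSpace.PseudoMetrizableSpace X]
    [SecondCountableTopology X] [MeasurableSpace X] [BorelSpace X]
    [TopologicalSpace Y] [TopologicalSpace.PseudoMetrizableSpace Y] [SecondCountableTopology Y]
    [MeasurableSpace Y] [BorelSpace Y]
    {G : Type*} [NormedAddCommGroup G] [InnerProductSpace ℝ G] [CompleteSpace G]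
    [MeasurableSpace G] [BorelSpace G]
    {H : Type*} [NormedAddCommGroup H] [InnerProductSpace ℝ H] [CompleteSpace H] [RKHS ℝ H X G]
    (hcont : ∀ f : H, Continuous (f : X → G))
    (hbdd : BddAbove (Set.range fun x : X => Real.sqrt ‖RKHS.kernel H x x‖))
    (hfeature : Continuous fun x : X => RKHS.kerFun H x)
    (L : X → Y → G → ℝ) (hL : IsLoss L) (hconvex : IsConvexLoss L) (hdiff : IsContDiffLoss L)
    (hlip : IsLocallyLipschitzLoss L) (hlocbdd : IsLocallyBoundedLoss L)
    (Z : ℕ → Ω → X × Y) (J : Ω → ProbabilityMeasure (X × Y))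
    (hrich : ∀ᵐ ω ∂P, IsRich (Set.range fun f : H => (f : X → G)) L (J ω)) :
    (∀ lam : ℝ, 0 < lam → ∀ (n : ℕ) (z : Fin (n + 1) → X × Y),
      ∃! f : H, IsSVMSolution L lam z f) ∧
    (IsEWCInProb P Z J → ∃ lam : ℕ → ℝ, (∀ n, 0 < lam n) ∧ Tendsto lam atTop (𝓝 0) ∧
      IsConsistent P L (svm H (fun f => (hcont f).measurable) L lam) Z J) ∧
    (IsEWCAlmostSurely P Z J → ∃ lam : ℕ → ℝ, (∀ n, 0 < lam n) ∧ Tendsto lam atTop (𝓝 0) ∧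
      IsStronglyConsistent P L (svm H (fun f => (hcont f).measurable) L lam) Z J) := by
  have hℓ : IsSmoothConvexIntegrand (pointwiseLoss H L) :=
    isSmoothConvexIntegrand_pointwiseLoss hcont hbdd hfeature hL hconvex hdiff hlip hlocbdd
  obtain ⟨lam, -, hpos, hlam⟩ := exists_seq_strictAnti_tendsto (0 : ℝ)
  refine ⟨fun lam hlam n z => existsUnique_isSVMSolution hℓ hlam, fun hZ => ?_, fun hZ => ?_⟩
  · obtain ⟨κ, hκ, hcons⟩ := exists_isConsistent_svm _ hℓ hpos hlam hrich hZ
    exact ⟨lam ∘ κ, fun n => hpos _, hlam.comp hκ, hcons⟩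
  · obtain ⟨κ, hκ, hcons⟩ := exists_isStronglyConsistent_svm _ hℓ hpos hlam hrich hZ
    exact ⟨lam ∘ κ, fun n => hpos _, hlam.comp hκ, hcons⟩

end EWCConsistency

end

theorem mainTheorem1
    -- the probability space
    {Ω : Type*} [MeasurableSpace Ω] (P : Measure Ω) [IsProbabilityMeasure P]
    -- the input space: a locally compact Polish space with its Borel σ-algebra
    {X : Type*} [TopologicalSpace X] [PolishSpace X] [LocallyCompactSpace X]
    [MeasurableSpace X] [BorelSpace X]
    -- the separable Hilbert space of outputs, and the complete set in which data live
    {G : Type*} [NormedAddCommGroup G] [InnerProductSpace ℝ G] [CompleteSpace G]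
    [TopologicalSpace.SeparableSpace G] [MeasurableSpace G] [BorelSpace G]
    (Y : Set G) (hY : IsComplete Y)
    -- the separable reproducing kernel Hilbert space of continuous functions
    {H : Type*} [NormedAddCommGroup H] [InnerProductSpace ℝ H] [CompleteSpace H]
    [TopologicalSpace.SeparableSpace H] [RKHS ℝ H X G]
    (hcont : ∀ f : H, Continuous (f : X → G))
    (hbdd : BddAbove (Set.range fun x : X => Real.sqrt ‖RKHS.kernel H x x‖))
    (hfeature : Continuous fun x : X => RKHS.kerFun H x)
    (hsep : TopologicalSpace.SeparableSpace ((X × Y) →ᵇ H))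
    -- the loss
    (L : X → Y → G → ℝ) (hL : EWCConsistency.IsLoss L)
    (hconvex : EWCConsistency.IsConvexLoss L)
    (hdiff : EWCConsistency.IsContDiffLoss L)
    (hlip : EWCConsistency.IsLocallyLipschitzLoss L)
    (hlocbdd : EWCConsistency.IsLocallyBoundedLoss L)
    -- the input-output process and the random limit measure
    (Z : ℕ → Ω → X × Y) (J : Ω → ProbabilityMeasure (X × Y))
    (hrich : ∀ᵐ ω ∂P,
      EWCConsistency.IsRich (Set.range fun f : H => (f : X → G)) L (J ω)) :
    -- the SVM is well defined
    (∀ lam : ℝ, 0 < lam → ∀ (n : ℕ) (z : Fin (n + 1) → X × Y),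
      ∃! f : H, EWCConsistency.IsSVMSolution L lam z f) ∧
    -- consistency
    (EWCConsistency.IsEWCInProb P Z J →
      ∃ lam : ℕ → ℝ, (∀ n, 0 < lam n) ∧ Tendsto lam atTop (𝓝 0) ∧
        EWCConsistency.IsConsistent P L
          (EWCConsistency.svm H (fun f => (hcont f).measurable) L lam) Z J) ∧
    -- strong consistency
    (EWCConsistency.IsEWCAlmostSurely P Z J →
      ∃ lam : ℕ → ℝ, (∀ n, 0 < lam n) ∧ Tendsto lam atTop (𝓝 0) ∧
        EWCConsistency.IsStronglyConsistent P L
          (EWCConsistency.svm H (fun f => (hcont f).measurable) L lam) Z J) := by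
  have := UniformSpace.secondCountable_of_separable G
  exact EWCConsistency.mainTheorem1_general P hcont hbdd hfeature L hL hconvex hdiff hlip hlocbdd
    Z J hrich
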